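/- Let $\lambda_l,\lambda_e\ge 0$, $p\in[0,1]$ and $\eta,\beta_l,\beta_e>0$. Let $\Phi_l$ (legitimate nodes) and $\Phi_e$ (eavesdroppers) be independent homogeneous Poisson point processes in $\mathbb{R}^2$ with densities $\lambda_l$ and $\lambda_e$. In a given time slot each node of $\Phi_l$ transmits with probability $p$, independently of the other nodes, of all positions and of $\Phi_e$; let $\Phi_t\subseteq\Phi_l$ be the set of transmitting nodes and $\Phi_r=\Phi_l\setminus\Phi_t$ the set of receiving nodes. A transmitter $x$ can securely connect to a receiver $y$ if (C1) $\|x-y\|_2<\eta$; (C2) the disk of radius $\beta_l\|x-y\|_2$ centred at $y$ contains no transmitter other than $x$; and (C3) the disk of radius $\beta_e\|x-y\|_2$ centred at $x$ contains no point of $\Phi_e$. Let $N_{r,0}$ be the number of transmitters in $\Phi_t$ that can securely connect to a receiver placed at the origin (a typical receiver), and let $N_{t,0}$ be the number of receivers in $\Phi_r$ to which a transmitter placed at the origin can securely connect. Then $$\mathbb{E} N_{r,0}=\frac{\lambda_l p\,\bigl[1-\exp\bigl(-(\lambda_l p\beta_l^2+\lambda_e\beta_e^2)\pi\eta^2\bigr)\bigr]}{\lambda_l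 p\beta_l^2+\lambda_e\beta_e^2},$$ where the right-hand side is read as $0$ if $\lambda_l p=\lambda_e=0$. Moreover, if $p<1$, then $$\mathbb{E}N_{r,0}=\frac{p}{1-p}\,\mathbb{E}N_{t,0}.$$ -/

import Mathlib

open MeasureTheory ProbabilityTheory
open scoped NNReal ENNReal

noncomputable section

/-- The Euclidean plane. -/
abbrev Plane : Type := EuclideanSpace ℝ (Fin 2)

section PointProcess

variable {Ω : Type*}

/-- The number of points of the random set `Φ` in the region `B`. -/
def count (Φ : Ω → Set Plane) (B : Set Plane) (ω : Ω) : ℕ∞ := (Φ ω ∩ B).encard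

/-- The σ-algebra on `Ω` generated by a random set, that is, by all its counts in Borel sets. -/
@[reducible] def sigmaOf (Φ : Ω → Set Plane) : MeasurableSpace Ω :=
  ⨆ (B : Set Plane) (_ : MeasurableSet B), MeasurableSpace.comap (count Φ B) inferInstance

/-- `Φ` is a homogeneous Poisson point process of density `lam` on the plane. -/
structure IsPoissonProcess [MeasurableSpace Ω] (P : Measure Ω) (Φ : Ω → Set Plane)
    (lam : ℝ≥0) : Prop where
  measurable_count : ∀ B, MeasurableSet B → Measurable (count Φ B)
  locallyFinite : ∀ᵐ ω ∂P, ∀ B, Bornology.IsBounded B → (Φ ω ∩ B).Finite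
  law_count : ∀ B, MeasurableSet B → Bornology.IsBounded B →
    P.map (count Φ B) =
      (poissonMeasure (lam * (volume B).toNNReal)).map (fun n : ℕ => (n : ℕ∞))
  indep_count : ∀ (n : ℕ) (B : Fin n → Set Plane), (∀ i, MeasurableSet (B i)) →
    Pairwise (Function.onFun Disjoint B) → iIndepFun (fun i => count Φ (B i)) P

end PointProcess

/-- The random data of the network in one time slot: the legitimate nodes are enumerated as
`node i` for `i < num` (their number may be infinite), `tx i` tells whether node `i` transmits,
and `eves` is the set of eavesdroppers. -/
structure Network (Ω : Type*) where
  num : Ω → ℕ∞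
  node : ℕ → Ω → Plane
  tx : ℕ → Ω → Bool
  eves : Ω → Set Plane

namespace Network

variable {Ω : Type*} (N : Network Ω)

/-- The legitimate nodes. -/
def legit (ω : Ω) : Set Plane := {x | ∃ i : ℕ, (i : ℕ∞) < N.num ω ∧ N.node i ω = x}

/-- The transmitting nodes. -/
def transmitters (ω : Ω) : Set Plane :=
  {x | ∃ i : ℕ, (i : ℕ∞) < N.num ω ∧ N.tx i ω = true ∧ N.node i ω = x}

/-- The receiving nodes: all legitimate nodes that do not transmit (half-duplex). -/
def receivers (ω : Ω) : Set Plane := N.legit ω \ N.transmitters ω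

/-- The stochastic model: legitimate nodes and eavesdroppers form independent Poisson processes
of densities `lamL` and `lamE`, and every legitimate node transmits with probability `p`,
independently of the other nodes, of all positions and of the eavesdroppers (slotted ALOHA). -/
structure IsAlohaModel [MeasurableSpace Ω] (P : Measure Ω) (lamL lamE : ℝ≥0) (p : ℝ) :
    Prop where
  measurable_num : Measurable N.num
  measurable_node : ∀ i, Measurable (N.node i)
  measurable_tx : ∀ i, Measurable (N.tx i)
  /-- no node is listed twice -/
  node_injOn : ∀ᵐ ω ∂P, Set.InjOn (fun i => N.node i ω) {i : ℕ | (i : ℕ∞) < N.num ω}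
  poisson_legit : IsPoissonProcess P N.legit lamL
  poisson_eves : IsPoissonProcess P N.eves lamE
  prob_tx : ∀ i, P {ω | N.tx i ω = true} = ENNReal.ofReal p
  indep_tx : iIndepFun N.tx P
  indep_node_tx :
    IndepFun (fun ω => (N.num ω, fun i => N.node i ω)) (fun ω i => N.tx i ω) P
  indep_eves :
    Indep (MeasurableSpace.comap
      (fun ω => ((N.num ω, fun i => N.node i ω), fun i => N.tx i ω)) inferInstance)
      (sigmaOf N.eves) P

end Network

/-- The transmitter `x` can securely connect to the receiver `y`, when `T`, `R`, `E` are the sets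
of transmitters, receivers and eavesdroppers. -/
structure SecureEdge (η βl βe : ℝ) (T R E : Set Plane) (x y : Plane) : Prop where
  mem_T : x ∈ T
  mem_R : y ∈ R
  close : ‖x - y‖ < η
  /-- no transmitter other than `x` itself is within `βl * ‖x - y‖` of the receiver -/
  no_interferer : ∀ z ∈ T, z ≠ x → z ∉ Metric.ball y (βl * ‖x - y‖)
  no_eavesdropper : ∀ z ∈ E, z ∉ Metric.ball x (βe * ‖x - y‖)

/-- Secure in-degree of a receiver placed at the origin. -/
def Network.inDegree {Ω : Type*} (N : Network Ω) (η βl βe : ℝ) (ω : Ω) : ℕ∞ :=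
  {x | SecureEdge η βl βe (N.transmitters ω) (insert 0 (N.receivers ω)) (N.eves ω) x 0}.encard

/-- Secure out-degree of a transmitter placed at the origin. -/
def Network.outDegree {Ω : Type*} (N : Network Ω) (η βl βe : ℝ) (ω : Ω) : ℕ∞ :=
  {y | SecureEdge η βl βe (insert 0 (N.transmitters ω)) (N.receivers ω) (N.eves ω) 0 y}.encard

end

/-!
The weights of the Poisson law of mean `r` satisfy `(n + 1) * w (n + 1) = r * w n`. Together with
the independence of the counts in disjoint regions this gives the reduced Mecke formula: the pair
formed by a point of a Poisson process and the configuration of all its other points has the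
intensity measure `lam • volume ⊗ law of the process`. Indeed, both measures agree on the products
of a bounded region `A` with the event that a bounded region `U` is void, and these generate the
σ-algebra.

A link at the origin with the node `x` is secure if `x` is in the right mode, no other transmitter
lies in one disk determined by `x` and no eavesdropper lies in another one. By independence of the
eavesdroppers, the modes and the positions, the conditional probability of this event given the
positions is the mode probability times `(1 - p) ^ n` times a void probability, where `n` is the
number of other nodes in the first disk. By Mecke's formula and the generating function of the
Poisson law, the power averages to the probability that a process of density `lamL * p` leaves
that disk void. The expected degree is therefore a Gaussian integral over the disk of radius `η`,
which is computed in polar coordinates, and the mode probability `p` or `1 - p` is all that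
distinguishes the two degrees.
-/

open Filter Metric TopologicalSpace Topology

section PoissonLaw

theorem lintegral_poissonMeasure (r : ℝ≥0) (f : ℕ → ℝ≥0∞) :
    ∫⁻ n, f n ∂(poissonMeasure r) =
      ∑' n : ℕ, f n * ENNReal.ofReal (Real.exp (-r) * r ^ n / n.factorial) := by
  rw [lintegral_countable']
  simp_rw [poissonMeasure_singleton]

/-- The Poisson weights satisfy `(n + 1) * w (n + 1) = r * w n`, which is the whole content of
Mecke's formula. -/
theorem lintegral_natCast_mul_poissonMeasure (r : ℝ≥0) (f : ℕ → ℝ≥0∞) :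
    ∫⁻ n, n * f n ∂(poissonMeasure r) = r * ∫⁻ n, f (n + 1) ∂(poissonMeasure r) := by
  rw [lintegral_poissonMeasure, lintegral_poissonMeasure, tsum_eq_zero_add' ENNReal.summable,
    Nat.cast_zero, zero_mul, zero_mul, zero_add, ← ENNReal.tsum_mul_left]
  refine tsum_congr fun n => ?_
  have weight_succ : ((n + 1 : ℕ) : ℝ≥0∞) *
      ENNReal.ofReal (Real.exp (-r) * r ^ (n + 1) / (n + 1).factorial) =
        r * ENNReal.ofReal (Real.exp (-r) * r ^ n / n.factorial) := by
    rw [← ENNReal.ofReal_natCast, ← ENNReal.ofReal_coe_nnreal,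
      ← ENNReal.ofReal_mul (Nat.cast_nonneg _), ← ENNReal.ofReal_mul r.coe_nonneg]
    congr 1
    rw [Nat.factorial_succ, pow_succ]
    push_cast
    field_simp
  rw [mul_right_comm, weight_succ]
  ring

theorem lintegral_pow_poissonMeasure (r q : ℝ≥0) :
    ∫⁻ n, (q : ℝ≥0∞) ^ n ∂(poissonMeasure r) = ENNReal.ofReal (Real.exp (-((1 - q) * r))) := by
  have hasSum_series : HasSum (fun n : ℕ => Real.exp (-r) * ((q * r : ℝ) ^ n / n.factorial))
      (Real.exp (-r) * Real.exp (q * r)) := by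
    have := NormedSpace.expSeries_div_hasSum_exp (q * r : ℝ)
    rw [← Real.exp_eq_exp_ℝ] at this
    exact this.mul_left _
  rw [lintegral_poissonMeasure, show -((1 - (q : ℝ)) * r) = -r + q * r by ring, Real.exp_add,
    ← hasSum_series.tsum_eq,
    ENNReal.ofReal_tsum_of_nonneg (fun n => by positivity) hasSum_series.summable]
  refine tsum_congr fun n => ?_
  rw [← ENNReal.ofReal_coe_nnreal, ← ENNReal.ofReal_pow q.coe_nonneg,
    ← ENNReal.ofReal_mul (by positivity)]
  congr 1
  ring

end PoissonLaw

section Configurations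

variable {X : Type*}

/-- A point configuration in `X`. This is a copy of `Set X` that carries the σ-algebra generated by
the void events of bounded Borel sets instead of the product σ-algebra. -/
structure Config (X : Type*) where
  points : Set X

/-- The event that a configuration has no point in `U`. -/
def voidEvent (U : Set X) : Set (Config X) := {S | Disjoint S.points U}

/-- The number of points of a configuration in `B`. -/
noncomputable def Config.numPoints (S : Config X) (B : Set X) : ℕ∞ := (S.points ∩ B).encard

theorem mem_voidEvent_iff_numPoints_eq_zero {S : Config X} {U : Set X} :
    S ∈ voidEvent U ↔ S.numPoints U = 0 :=
  Set.disjoint_iff_inter_eq_empty.trans Set.encard_eq_zero.symm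

/-- The void events of bounded Borel sets; they form a π-system. -/
def boundedVoidEvents (X : Type*) [Bornology X] [MeasurableSpace X] : Set (Set (Config X)) :=
  voidEvent '' {U | MeasurableSet U ∧ Bornology.IsBounded U}

instance [Bornology X] [MeasurableSpace X] : MeasurableSpace (Config X) :=
  .generateFrom (boundedVoidEvents X)

theorem isPiSystem_boundedVoidEvents [Bornology X] [MeasurableSpace X] :
    IsPiSystem (boundedVoidEvents X) := by
  rintro _ ⟨U, ⟨hU, hUb⟩, rfl⟩ _ ⟨V, ⟨hV, hVb⟩, rfl⟩ -
  exact ⟨U ∪ V, ⟨hU.union hV, hUb.union hVb⟩, Set.ext fun _ => disjoint_sup_right⟩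

theorem measurableSet_voidEvent [Bornology X] [MeasurableSpace X] {U : Set X}
    (hU : MeasurableSet U) (hUb : Bornology.IsBounded U) : MeasurableSet (voidEvent U) :=
  MeasurableSpace.measurableSet_generateFrom ⟨U, ⟨hU, hUb⟩, rfl⟩

theorem measurable_config_of_measurableSet_disjoint {Ω : Type*} {mΩ : MeasurableSpace Ω}
    [Bornology X] [MeasurableSpace X] {Φ : Ω → Config X}
    (h : ∀ U, MeasurableSet U → MeasurableSet (Φ ⁻¹' voidEvent U)) : Measurable Φ := by
  refine measurable_generateFrom ?_
  rintro _ ⟨U, ⟨hU, -⟩, rfl⟩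
  exact h U hU

theorem isPiSystem_isBounded_measurableSet [Bornology X] [MeasurableSpace X] :
    IsPiSystem {A : Set X | MeasurableSet A ∧ Bornology.IsBounded A} :=
  fun _ hA _ hB _ => ⟨hA.1.inter hB.1, hA.2.subset Set.inter_subset_left⟩

theorem generateFrom_isBounded_measurableSet [PseudoMetricSpace X] [mX : MeasurableSpace X]
    [OpensMeasurableSpace X] :
    MeasurableSpace.generateFrom {A : Set X | MeasurableSet A ∧ Bornology.IsBounded A} = mX := by
  refine le_antisymm (MeasurableSpace.generateFrom_le fun _ hA => hA.1) fun A hA => ?_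
  rcases isEmpty_or_nonempty X with hX | ⟨⟨x⟩⟩
  · rw [Set.eq_empty_of_isEmpty A]
    exact MeasurableSpace.measurableSet_empty _
  · rw [← Set.inter_univ A, ← iUnion_ball_nat x, Set.inter_iUnion]
    exact MeasurableSet.iUnion fun n => MeasurableSpace.measurableSet_generateFrom
      ⟨hA.inter measurableSet_ball, isBounded_ball.subset Set.inter_subset_right⟩

variable [MetricSpace X] {c : ℕ → X} {δ : ℕ → ℝ}

theorem exists_pairwiseDisjoint_balls (hc : DenseRange c) (hδ0 : ∀ n, 0 < δ n)
    (hδ : Tendsto δ atTop (𝓝 0)) {y : X} {s : ℝ} {T : Finset X} (hT : ↑T ⊆ ball y s) :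
    ∃ n, ∃ k : X → ℕ, (T : Set X).PairwiseDisjoint (fun x => ball (c (k x)) (δ n)) ∧
      ∀ x ∈ T, x ∈ ball (c (k x)) (δ n) ∧ dist (c (k x)) y + δ n ≤ s := by
  have separated : ∀ᶠ n in atTop, ∀ x ∈ T, ∀ z ∈ T, x ≠ z → 4 * δ n < dist x z := by
    simp only [Finset.eventually_all, eventually_imp_distrib_left]
    intro x _ z _ hxz
    have : Tendsto (fun n => 4 * δ n) atTop (𝓝 0) := by simpa using hδ.const_mul 4
    exact this.eventually_lt_const (dist_pos.2 hxz)
  have inside : ∀ᶠ n in atTop, ∀ x ∈ T, dist x y + 2 * δ n < s := by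
    rw [Finset.eventually_all]
    intro x hx
    have : Tendsto (fun n => dist x y + 2 * δ n) atTop (𝓝 (dist x y)) := by
      simpa using (hδ.const_mul 2).const_add (dist x y)
    exact this.eventually_lt_const (hT hx)
  obtain ⟨n, hsep, hins⟩ := (separated.and inside).exists
  choose k hk using fun x => hc.exists_dist_lt x (hδ0 n)
  refine ⟨n, k, fun x hx z hz hxz => ball_disjoint_ball ?_, fun x hx => ⟨hk x, ?_⟩⟩
  · linarith [hsep x hx z hz hxz, hk x, hk z, dist_triangle4_right x z (c (k x)) (c (k z)), hδ0 n]
  · linarith [hins x hx, dist_triangle_left (c (k x)) y x, hk x]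

/-- This expresses the number of points in a ball through countably many void events of fixed
balls, jointly measurably in the ball and the configuration. -/
theorem natCast_le_numPoints_ball_iff (hc : DenseRange c) (hδ0 : ∀ n, 0 < δ n)
    (hδ : Tendsto δ atTop (𝓝 0)) (S : Config X) (y : X) (s : ℝ) (m : ℕ) :
    m ≤ S.numPoints (ball y s) ↔ ∃ n, ∃ t : Finset ℕ,
      (t.card = m ∧ (t : Set ℕ).PairwiseDisjoint (fun k => ball (c k) (δ n))) ∧
      ∀ k ∈ t, dist (c k) y + δ n ≤ s ∧ S ∉ voidEvent (ball (c k) (δ n)) := by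
  classical
  constructor
  · intro h
    obtain ⟨T, hTS, hTm⟩ := Set.exists_subset_encard_eq h
    lift T to Finset X using Set.finite_of_encard_eq_coe hTm
    rw [Set.encard_coe_eq_coe_finsetCard, Nat.cast_inj] at hTm
    obtain ⟨n, k, hdisj, hk⟩ :=
      exists_pairwiseDisjoint_balls hc hδ0 hδ (hTS.trans Set.inter_subset_right)
    have hkinj : Set.InjOn k T := fun x hx z hz hxz =>
      hdisj.elim hx hz (Set.not_disjoint_iff.2 ⟨x, (hk x hx).1, hxz ▸ (hk x hx).1⟩)
    refine ⟨n, T.image k, ⟨by rw [Finset.card_image_of_injOn hkinj, hTm], ?_⟩, ?_⟩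
    · rwa [Finset.coe_image, Set.InjOn.pairwiseDisjoint_image hkinj]
    · simp only [Finset.forall_mem_image]
      exact fun x hx => ⟨(hk x hx).2, Set.not_disjoint_iff.2 ⟨x, (hTS hx).1, (hk x hx).1⟩⟩
  · rintro ⟨n, t, ⟨rfl, hdisj⟩, ht⟩
    have : Nonempty X := ⟨y⟩
    choose! x hx using fun k hk => Set.not_disjoint_iff.1 (ht k hk).2
    have hxinj : Set.InjOn x t := fun j hj k hk hjk =>
      hdisj.elim hj hk (Set.not_disjoint_iff.2 ⟨x j, (hx j hj).2, hjk ▸ (hx k hk).2⟩)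
    rw [← Set.encard_coe_eq_coe_finsetCard, ← hxinj.encard_image]
    refine Set.encard_le_encard ?_
    rintro _ ⟨k, hk, rfl⟩
    exact ⟨(hx k hk).1, ball_subset_ball' (by linarith [(ht k hk).1]) (hx k hk).2⟩

theorem measurable_of_measurableSet_natCast_le {α : Type*} [MeasurableSpace α] {f : α → ℕ∞}
    (h : ∀ m : ℕ, MeasurableSet {a | (m : ℕ∞) ≤ f a}) : Measurable f := by
  refine ENat.measurable_iff.2 fun m => ?_
  convert (h m).diff (h (m + 1)) using 1
  ext a
  simp only [Set.mem_preimage, Set.mem_singleton_iff, Set.mem_sdiff, Set.mem_ofPred_eq, not_le,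
    Nat.cast_add, Nat.cast_one]
  rw [ENat.lt_add_one_iff (ENat.natCast_ne_top m), le_antisymm_iff, and_comm]

variable [SeparableSpace X] [MeasurableSpace X] [OpensMeasurableSpace X]

theorem measurable_numPoints_ball :
    Measurable fun v : (X × ℝ) × Config X => v.2.numPoints (ball v.1.1 v.1.2) := by
  rcases isEmpty_or_nonempty X with hX | hX
  · have : IsEmpty ((X × ℝ) × Config X) := ⟨fun v => hX.elim v.1.1⟩
    exact measurable_of_empty _
  refine measurable_of_measurableSet_natCast_le fun m => ?_
  simp only [natCast_le_numPoints_ball_iff (denseRange_denseSeq X)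
    (δ := fun n : ℕ => 1 / ((n : ℝ) + 1)) (fun _ => Nat.one_div_pos_of_nat)
    tendsto_one_div_add_atTop_nhds_zero_nat]
  refine measurableSet_setOfPred.2 (Measurable.exists fun n => Measurable.exists fun t =>
    measurable_const.and (Measurable.forall fun k => measurable_const.imp (.and ?_ (.not ?_))))
  · exact measurableSet_setOfPred.1 (measurableSet_le (by fun_prop) (by fun_prop))
  · exact measurableSet_setOfPred.1
      (measurable_snd (measurableSet_voidEvent measurableSet_ball isBounded_ball))

theorem measurableSet_mem_voidEvent_ball :
    MeasurableSet {v : (X × ℝ) × Config X | v.2 ∈ voidEvent (ball v.1.1 v.1.2)} := by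
  simp only [mem_voidEvent_iff_numPoints_eq_zero]
  exact measurable_numPoints_ball (measurableSet_singleton 0)

end Configurations

theorem measurable_config_sigmaOf {Ω : Type*} (Φ : Ω → Set Plane) :
    Measurable[sigmaOf Φ] fun ω => Config.mk (Φ ω) := by
  refine measurable_config_of_measurableSet_disjoint (mΩ := sigmaOf Φ) fun U hU => ?_
  have hcount : Measurable[sigmaOf Φ] (count Φ U) := by
    rw [measurable_iff_comap_le]
    exact le_iSup₂_of_le U hU le_rfl
  convert @hcount {0} (measurableSet_singleton 0) using 1
  exact Set.ext fun _ => mem_voidEvent_iff_numPoints_eq_zero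

namespace IsPoissonProcess

variable {Ω : Type*} [MeasurableSpace Ω] {P : Measure Ω} {Φ : Ω → Set Plane} {lam : ℝ≥0}
  {A B : Set Plane}

theorem lintegral_count (h : IsPoissonProcess P Φ lam) (hB : MeasurableSet B)
    (hBb : Bornology.IsBounded B) (f : ℕ∞ → ℝ≥0∞) :
    ∫⁻ ω, f (count Φ B ω) ∂P =
      ∫⁻ n : ℕ, f n ∂(poissonMeasure (lam * (volume B).toNNReal)) := by
  rw [← lintegral_map (f := f) .of_discrete (h.measurable_count B hB), h.law_count B hB hBb,
    lintegral_map .of_discrete .of_discrete]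

theorem lintegral_count_mul (h : IsPoissonProcess P Φ lam) (hB : MeasurableSet B)
    (hBb : Bornology.IsBounded B) (f : ℕ∞ → ℝ≥0∞) :
    ∫⁻ ω, count Φ B ω * f (count Φ B ω) ∂P =
      lam * volume B * ∫⁻ ω, f (count Φ B ω + 1) ∂P := by
  rw [h.lintegral_count hB hBb (fun n => n * f n), h.lintegral_count hB hBb (fun n => f (n + 1))]
  simp only [ENat.toENNReal_coe]
  rw [lintegral_natCast_mul_poissonMeasure _ fun n => f n, ENNReal.coe_mul,
    ENNReal.coe_toNNReal hBb.measure_lt_top.ne]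
  simp only [Nat.cast_add, Nat.cast_one]

theorem lintegral_pow_toNat_count (h : IsPoissonProcess P Φ lam) (hB : MeasurableSet B)
    (hBb : Bornology.IsBounded B) (q : ℝ≥0) :
    ∫⁻ ω, (q : ℝ≥0∞) ^ (count Φ B ω).toNat ∂P =
      ENNReal.ofReal (Real.exp (-((1 - q) * (lam * volume.real B)))) := by
  rw [h.lintegral_count hB hBb (fun n => (q : ℝ≥0∞) ^ n.toNat)]
  simp only [ENat.toNat_natCast]
  exact lintegral_pow_poissonMeasure _ _

theorem measure_count_eq_zero (h : IsPoissonProcess P Φ lam) (hB : MeasurableSet B)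
    (hBb : Bornology.IsBounded B) :
    P {ω | count Φ B ω = 0} = ENNReal.ofReal (Real.exp (-(lam * volume.real B))) := by
  have count_law : P {ω | count Φ B ω = 0} = P.map (count Φ B) {((0 : ℕ) : ℕ∞)} :=
    (Measure.map_apply (h.measurable_count B hB) (measurableSet_singleton _)).symm
  rw [count_law, h.law_count B hB hBb, Measure.map_apply .of_discrete (measurableSet_singleton _),
    ← Set.image_singleton, Set.preimage_image_eq _ Nat.cast_injective, poissonMeasure_singleton]
  simp [measureReal_def, ENNReal.toReal]

theorem indepFun_count (h : IsPoissonProcess P Φ lam) (hA : MeasurableSet A)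
    (hB : MeasurableSet B) (hAB : Disjoint A B) : IndepFun (count Φ A) (count Φ B) P := by
  have := h.indep_count 2 ![A, B] (by simp [Fin.forall_fin_two, hA, hB])
    (by
      intro i j hij
      fin_cases i <;> fin_cases j <;> simp_all [Function.onFun, hAB.symm])
  simpa using this.indepFun (i := 0) (j := 1) (by decide)

theorem lintegral_mul_of_disjoint (h : IsPoissonProcess P Φ lam) (hA : MeasurableSet A)
    (hB : MeasurableSet B) (hAB : Disjoint A B) (f g : ℕ∞ → ℝ≥0∞) :
    ∫⁻ ω, f (count Φ A ω) * g (count Φ B ω) ∂P =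
      (∫⁻ ω, f (count Φ A ω) ∂P) * ∫⁻ ω, g (count Φ B ω) ∂P :=
  lintegral_mul_eq_lintegral_mul_lintegral_of_indepFun
    (Measurable.of_discrete.comp (h.measurable_count A hA))
    (Measurable.of_discrete.comp (h.measurable_count B hB))
    ((h.indepFun_count hA hB hAB).comp .of_discrete .of_discrete)

theorem ae_notMem (h : IsPoissonProcess P Φ lam) [IsProbabilityMeasure P] (x : Plane) :
    ∀ᵐ ω ∂P, x ∉ Φ ω := by
  have hx := MeasurableSet.singleton x
  have void_prob := h.measure_count_eq_zero hx Bornology.isBounded_singleton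
  rw [show volume.real {x} = 0 by simp [measureReal_def], mul_zero, neg_zero, Real.exp_zero,
    ENNReal.ofReal_one] at void_prob
  have void_ae : ∀ᵐ ω ∂P, count Φ {x} ω = 0 :=
    (ae_iff_prob_eq_one ((h.measurable_count _ hx).eq measurable_const)).2 void_prob
  filter_upwards [void_ae] with ω hω hxω
  exact (Set.encard_eq_zero.1 hω).le ⟨hxω, rfl⟩

theorem sigmaOf_le (h : IsPoissonProcess P Φ lam) :
    sigmaOf Φ ≤ ‹MeasurableSpace Ω› :=
  iSup₂_le fun B hB => (h.measurable_count B hB).comap_le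

theorem measurable_config (h : IsPoissonProcess P Φ lam) : Measurable fun ω => Config.mk (Φ ω) :=
  (measurable_config_sigmaOf Φ).mono h.sigmaOf_le le_rfl

theorem measure_disjoint (h : IsPoissonProcess P Φ lam) (hB : MeasurableSet B)
    (hBb : Bornology.IsBounded B) :
    P {ω | Disjoint (Φ ω) B} = ENNReal.ofReal (Real.exp (-(lam * volume.real B))) := by
  simp only [← h.measure_count_eq_zero hB hBb, count, Set.encard_eq_zero,
    Set.disjoint_iff_inter_eq_empty]

end IsPoissonProcess

section RandomSets

theorem coe_encard_eq_tsum_indicator {ι : Type*} (I : Set ι) :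
    (I.encard : ℝ≥0∞) = ∑' i, I.indicator 1 i := by
  rw [← ENNReal.tsum_set_one, tsum_subtype I fun _ => (1 : ℝ≥0∞)]
  rfl

variable {Ω ι : Type*} [Countable ι] [MeasurableSpace Ω] {I : Ω → Set ι}

theorem measurable_coe_encard (hI : ∀ i, MeasurableSet {ω | i ∈ I ω}) :
    Measurable fun ω => ((I ω).encard : ℝ≥0∞) := by
  simp only [coe_encard_eq_tsum_indicator]
  exact Measurable.tsum fun i => measurable_one.indicator (hI i)

theorem lintegral_coe_encard {P : Measure Ω} (hI : ∀ i, MeasurableSet {ω | i ∈ I ω}) :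
    ∫⁻ ω, (I ω).encard ∂P = ∑' i, P {ω | i ∈ I ω} := by
  simp only [← lintegral_indicator_one (hI _)]
  rw [← lintegral_tsum fun i => (measurable_one.indicator (hI i)).aemeasurable]
  exact lintegral_congr fun ω => coe_encard_eq_tsum_indicator (I ω)

end RandomSets

section Enumerations

/-- The set of the points `pt i`, `i < num`. -/
def enumeratedSet {Ω X : Type*} (num : Ω → ℕ∞) (pt : ℕ → Ω → X) (ω : Ω) : Set X :=
  {x | ∃ i : ℕ, (i : ℕ∞) < num ω ∧ pt i ω = x}

/-- The configuration seen from the `i`-th point of an enumerated set: all the other points. -/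
def otherPoints {Ω X : Type*} (num : Ω → ℕ∞) (pt : ℕ → Ω → X) (i : ℕ) (ω : Ω) : Config X :=
  ⟨enumeratedSet num pt ω \ {pt i ω}⟩

/-- The reduced Campbell measure of an enumerated random set: the intensity measure of the pairs
formed by a point of the set and the configuration of all its other points. -/
noncomputable def reducedCampbellMeasure {Ω X : Type*} [MeasurableSpace Ω] [MeasurableSpace X]
    [Bornology X] (P : Measure Ω) (num : Ω → ℕ∞) (pt : ℕ → Ω → X) : Measure (X × Config X) :=
  .sum fun i : ℕ => (P.restrict {ω | (i : ℕ∞) < num ω}).map fun ω =>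
    (pt i ω, otherPoints num pt i ω)

/-- A measurable enumeration, almost surely without repetitions, of a random set. -/
structure IsEnumeration {Ω X : Type*} [MeasurableSpace Ω] [MeasurableSpace X] (P : Measure Ω)
    (num : Ω → ℕ∞) (pt : ℕ → Ω → X) : Prop where
  measurable_num : Measurable num
  measurable_pt : ∀ i, Measurable (pt i)
  injOn : ∀ᵐ ω ∂P, Set.InjOn (fun i => pt i ω) {i : ℕ | (i : ℕ∞) < num ω}

variable {Ω X : Type*} {num : Ω → ℕ∞} {pt : ℕ → Ω → X}

theorem image_setOf_lt_and_mem (T : Set X) (ω : Ω) :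
    (fun i => pt i ω) '' {i : ℕ | (i : ℕ∞) < num ω ∧ pt i ω ∈ T} = enumeratedSet num pt ω ∩ T := by
  ext x
  constructor
  · rintro ⟨i, ⟨hi, hiT⟩, rfl⟩
    exact ⟨⟨i, hi, rfl⟩, hiT⟩
  · rintro ⟨⟨i, hi, rfl⟩, hiT⟩
    exact ⟨i, ⟨hi, hiT⟩, rfl⟩

theorem otherPoints_mem_voidEvent_iff {i : ℕ} {ω : Ω} {U : Set X} :
    otherPoints num pt i ω ∈ voidEvent U ↔
      ∀ j : ℕ, (j : ℕ∞) < num ω → pt j ω ∈ U → pt j ω = pt i ω := by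
  refine Set.disjoint_left.trans ⟨fun h j hj hjU => ?_, ?_⟩
  · by_contra hne
    exact h ⟨⟨j, hj, rfl⟩, hne⟩ hjU
  · rintro h _ ⟨⟨j, hj, rfl⟩, hne⟩ hjU
    exact hne (h j hj hjU)

namespace IsEnumeration

variable [MeasurableSpace Ω] [MeasurableSpace X] {P : Measure Ω}

theorem measurableSet_lt_num (he : IsEnumeration P num pt) (i : ℕ) :
    MeasurableSet {ω | (i : ℕ∞) < num ω} :=
  he.measurable_num (.of_discrete (s := Set.Ioi (i : ℕ∞)))

variable [Bornology X] [MeasurableEq X]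

theorem measurable_otherPoints (he : IsEnumeration P num pt) (i : ℕ) :
    Measurable (otherPoints num pt i) := by
  refine measurable_config_of_measurableSet_disjoint fun U hU => ?_
  simp only [Set.preimage, otherPoints_mem_voidEvent_iff]
  refine measurableSet_setOfPred.2 (Measurable.forall fun j => .imp ?_ (.imp ?_ ?_))
  · exact measurableSet_setOfPred.1 (he.measurableSet_lt_num j)
  · exact measurableSet_setOfPred.1 (he.measurable_pt j hU)
  · exact measurableSet_setOfPred.1 (measurableSet_eq_fun (he.measurable_pt j) (he.measurable_pt i))

theorem measurable_point_otherPoints (he : IsEnumeration P num pt) (i : ℕ) :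
    Measurable fun ω => (pt i ω, otherPoints num pt i ω) :=
  (he.measurable_pt i).prodMk (he.measurable_otherPoints i)

theorem lintegral_reducedCampbellMeasure (he : IsEnumeration P num pt)
    {F : X × Config X → ℝ≥0∞} (hF : Measurable F) :
    ∫⁻ v, F v ∂reducedCampbellMeasure P num pt =
      ∑' i : ℕ, ∫⁻ ω in {ω | (i : ℕ∞) < num ω}, F (pt i ω, otherPoints num pt i ω) ∂P := by
  rw [reducedCampbellMeasure, lintegral_sum_measure]
  exact tsum_congr fun i => lintegral_map hF (he.measurable_point_otherPoints i)

theorem reducedCampbellMeasure_prod_voidEvent (he : IsEnumeration P num pt) {A U : Set X}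
    (hA : MeasurableSet A) (hU : MeasurableSet U) (hUb : Bornology.IsBounded U) :
    reducedCampbellMeasure P num pt (A ×ˢ voidEvent U) =
      ∫⁻ ω, (enumeratedSet num pt ω ∩
        {x ∈ A | Disjoint (enumeratedSet num pt ω \ {x}) U}).encard ∂P := by
  have hAU : MeasurableSet (A ×ˢ voidEvent U) := hA.prod (measurableSet_voidEvent hU hUb)
  let I : Ω → Set ℕ := fun ω =>
    {i | (i : ℕ∞) < num ω ∧ (pt i ω, otherPoints num pt i ω) ∈ A ×ˢ voidEvent U}
  have hI : ∀ i, MeasurableSet {ω | i ∈ I ω} := fun i =>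
    (he.measurableSet_lt_num i).inter (he.measurable_point_otherPoints i hAU)
  have campbell_apply : reducedCampbellMeasure P num pt (A ×ˢ voidEvent U) =
      ∑' i, P {ω | i ∈ I ω} := by
    rw [reducedCampbellMeasure, Measure.sum_apply _ hAU]
    refine tsum_congr fun i => ?_
    rw [Measure.map_apply (he.measurable_point_otherPoints i) hAU,
      Measure.restrict_apply (he.measurable_point_otherPoints i hAU), Set.inter_comm]
    rfl
  rw [campbell_apply, ← lintegral_coe_encard hI]
  refine lintegral_congr_ae ?_
  filter_upwards [he.injOn] with ω hinj
  rw [← image_setOf_lt_and_mem, Set.InjOn.encard_image (hinj.mono fun _ hi => hi.1)]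
  rfl

end IsEnumeration

end Enumerations

section MeckeFormula

theorem mem_inter_setOf_disjoint_sdiff_iff {X : Type*} {S A U : Set X} {x : X} :
    x ∈ S ∩ {x ∈ A | Disjoint (S \ {x}) U} ↔ x ∈ S ∧ x ∈ A ∧ ∀ z ∈ S, z ∈ U → z = x := by
  simp only [Set.mem_inter_iff, Set.mem_ofPred_eq, Set.disjoint_left, Set.mem_sdiff,
    Set.mem_singleton_iff, and_imp, not_imp_not]

/-- Either `S` does not meet `U`, and the points that are counted are all those of `S ∩ (A \ U)`, or
there is only one of them, the unique point of `S ∩ U`. -/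
theorem encard_inter_setOf_disjoint_sdiff {X : Type*} (S A U : Set X) :
    ((S ∩ {x ∈ A | Disjoint (S \ {x}) U}).encard : ℝ≥0∞) =
      (S ∩ (A \ U)).encard * (if (S ∩ U).encard = 0 then 1 else 0) +
        (S ∩ (A ∩ U)).encard * (if (S ∩ (A ∩ U)).encard = 1 then 1 else 0) *
          (if (S ∩ (U \ A)).encard = 0 then 1 else 0) := by
  simp only [Set.encard_eq_zero]
  by_cases hSU : S ∩ U = ∅
  · have notMem_U : ∀ x ∈ S, x ∉ U := fun x hx hxU => (hSU.subset ⟨hx, hxU⟩ : x ∈ (∅ : Set X))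
    have hAU : S ∩ (A ∩ U) = ∅ := Set.eq_empty_of_forall_notMem fun x hx => notMem_U x hx.1 hx.2.2
    have all_points : S ∩ {x ∈ A | Disjoint (S \ {x}) U} = S ∩ (A \ U) := by
      ext x
      rw [mem_inter_setOf_disjoint_sdiff_iff]
      exact ⟨fun hx => ⟨hx.1, hx.2.1, notMem_U x hx.1⟩,
        fun hx => ⟨hx.1, hx.2.1, fun z hz hzU => (notMem_U z hz hzU).elim⟩⟩
    simp [hSU, hAU, all_points]
  by_cases hU : ∃ x, S ∩ (A ∩ U) = {x} ∧ S ∩ (U \ A) = ∅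
  · obtain ⟨x, hx, hUA⟩ := hU
    obtain ⟨hxS, hxA, hxU⟩ : x ∈ S ∩ (A ∩ U) := hx ▸ rfl
    have eq_x : ∀ z ∈ S, z ∈ U → z = x := fun z hz hzU => by
      by_cases hzA : z ∈ A
      · exact hx.subset ⟨hz, hzA, hzU⟩
      · exact (hUA.subset ⟨hz, hzU, hzA⟩).elim
    have one_point : S ∩ {x ∈ A | Disjoint (S \ {x}) U} = {x} := by
      ext y
      rw [mem_inter_setOf_disjoint_sdiff_iff]
      exact ⟨fun hy => (hy.2.2 x hxS hxU).symm, by rintro rfl; exact ⟨hxS, hxA, eq_x⟩⟩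
    simp [hSU, hx, hUA, one_point]
  · have no_point : S ∩ {x ∈ A | Disjoint (S \ {x}) U} = ∅ := by
      refine Set.eq_empty_of_forall_notMem fun x hx => hU ⟨x, ?_⟩
      obtain ⟨hxS, hxA, hxU⟩ := mem_inter_setOf_disjoint_sdiff_iff.1 hx
      obtain ⟨z, hz, hzU⟩ := Set.nonempty_iff_ne_empty.2 hSU
      obtain rfl := hxU z hz hzU
      exact ⟨Set.eq_singleton_iff_unique_mem.2 ⟨⟨hz, hxA, hzU⟩, fun w hw => hxU w hw.1 hw.2.2⟩,
        Set.eq_empty_of_forall_notMem fun w hw => hw.2.2 (hxU w hw.1 hw.2.1 ▸ hxA)⟩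
    have not_single : ¬((S ∩ (A ∩ U)).encard = 1 ∧ S ∩ (U \ A) = ∅) := by
      rintro ⟨hone, hUA⟩
      obtain ⟨x, hx⟩ := Set.encard_eq_one.1 hone
      exact hU ⟨x, hx, hUA⟩
    rw [no_point, Set.encard_empty, if_neg hSU, mul_zero, zero_add, mul_assoc,
      ite_zero_mul_ite_zero, if_neg not_single, mul_zero, ENat.toENNReal_zero]

theorem ite_encard_inter_eq_zero {X : Type*} (S A U : Set X) :
    (if (S ∩ U).encard = 0 then 1 else 0 : ℝ≥0∞) =
      (if (S ∩ (A ∩ U)).encard = 0 then 1 else 0) *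
        (if (S ∩ (U \ A)).encard = 0 then 1 else 0) := by
  have hU : S ∩ U = ∅ ↔ S ∩ (A ∩ U) = ∅ ∧ S ∩ (U \ A) = ∅ := by
    rw [← Set.union_empty_iff, ← Set.inter_union_distrib_left, Set.inter_comm A,
      Set.inter_union_sdiff]
  simp only [Set.encard_eq_zero, hU, ite_zero_mul_ite_zero, mul_one]

variable {Ω : Type*} [MeasurableSpace Ω] {P : Measure Ω} {Φ : Ω → Set Plane} {lam : ℝ≥0}

theorem IsPoissonProcess.lintegral_encard_inter_setOf_disjoint_sdiff
    (h : IsPoissonProcess P Φ lam) [IsProbabilityMeasure P] {A U : Set Plane} (hA : MeasurableSet A)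
    (hAb : Bornology.IsBounded A) (hU : MeasurableSet U) :
    ∫⁻ ω, (Φ ω ∩ {x ∈ A | Disjoint (Φ ω \ {x}) U}).encard ∂P =
      lam * volume A * P {ω | Disjoint (Φ ω) U} := by
  let empty : ℕ∞ → ℝ≥0∞ := fun n => if n = 0 then 1 else 0
  let single : ℕ∞ → ℝ≥0∞ := fun n => if n = 1 then 1 else 0
  have hAU := hA.inter hU
  have disjoint_parts : Disjoint (A ∩ U) (U \ A) :=
    Set.disjoint_sdiff_right.mono_left Set.inter_subset_left
  have measurable_no_point : Measurable fun ω => count Φ (A \ U) ω * empty (count Φ U ω) :=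
    (Measurable.of_discrete.comp (h.measurable_count _ (hA.diff hU))).mul
      (Measurable.of_discrete.comp (g := empty) (h.measurable_count _ hU))
  have void_prob : ∫⁻ ω, empty (count Φ U ω) ∂P = P {ω | Disjoint (Φ ω) U} := by
    have hvoid : {ω | Disjoint (Φ ω) U} = count Φ U ⁻¹' {0} :=
      Set.ext fun ω => mem_voidEvent_iff_numPoints_eq_zero (S := ⟨Φ ω⟩)
    rw [hvoid, ← lintegral_indicator_one (h.measurable_count U hU (measurableSet_singleton 0))]
    exact lintegral_congr fun ω => by classical simp [empty, Set.indicator_apply]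
  have no_point_in_U : ∫⁻ ω, count Φ (A \ U) ω * empty (count Φ U ω) ∂P =
      lam * volume (A \ U) * ∫⁻ ω, empty (count Φ U ω) ∂P := by
    have mean := h.lintegral_count_mul (hA.diff hU) (hAb.subset Set.sdiff_subset) fun _ => 1
    simp only [mul_one, lintegral_one, measure_univ] at mean
    rw [h.lintegral_mul_of_disjoint (hA.diff hU) hU Set.disjoint_sdiff_left (fun n => n), mean]
  have one_point_in_U : ∫⁻ ω, count Φ (A ∩ U) ω * single (count Φ (A ∩ U) ω) *
        empty (count Φ (U \ A) ω) ∂P = lam * volume (A ∩ U) * ∫⁻ ω, empty (count Φ U ω) ∂P := by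
    have void_split : ∫⁻ ω, empty (count Φ U ω) ∂P =
        (∫⁻ ω, empty (count Φ (A ∩ U) ω) ∂P) * ∫⁻ ω, empty (count Φ (U \ A) ω) ∂P := by
      rw [← h.lintegral_mul_of_disjoint hAU (hU.diff hA) disjoint_parts]
      exact lintegral_congr fun ω => ite_encard_inter_eq_zero (Φ ω) A U
    rw [h.lintegral_mul_of_disjoint hAU (hU.diff hA) disjoint_parts (fun n => n * single n),
      h.lintegral_count_mul hAU (hAb.subset Set.inter_subset_left), void_split, mul_assoc]
    simp [single, empty]
  rw [← void_prob, ← measure_sdiff_add_inter A hU, mul_add, add_mul, ← no_point_in_U,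
    ← one_point_in_U, ← lintegral_add_left measurable_no_point]
  exact lintegral_congr fun ω => encard_inter_setOf_disjoint_sdiff (Φ ω) A U

variable [IsProbabilityMeasure P] {num : Ω → ℕ∞} {pt : ℕ → Ω → Plane}

theorem IsPoissonProcess.reducedCampbellMeasure_eq
    (h : IsPoissonProcess P (enumeratedSet num pt) lam) (he : IsEnumeration P num pt) :
    reducedCampbellMeasure P num pt =
      (lam • volume).prod (P.map fun ω => ⟨enumeratedSet num pt ω⟩) := by
  have hΦ := h.measurable_config
  have : IsProbabilityMeasure (P.map fun ω => Config.mk (enumeratedSet num pt ω)) :=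
    Measure.isProbabilityMeasure_map hΦ.aemeasurable
  have balls : (lam • volume : Measure Plane).FiniteSpanningSetsIn
      {A | MeasurableSet A ∧ Bornology.IsBounded A} :=
    ⟨fun n => ball 0 n, fun _ => ⟨measurableSet_ball, isBounded_ball⟩,
      fun _ => measure_ball_lt_top, iUnion_ball_nat 0⟩
  have whole : (P.map fun ω => Config.mk (enumeratedSet num pt ω)).FiniteSpanningSetsIn
      (boundedVoidEvents Plane) :=
    ⟨fun _ => voidEvent ∅, fun _ => ⟨∅, ⟨.empty, Bornology.isBounded_empty⟩, rfl⟩,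
      fun _ => measure_lt_top _ _, (Set.iUnion_const _).trans (by simp [voidEvent])⟩
  refine (Measure.prod_eq_generateFrom generateFrom_isBounded_measurableSet rfl
    isPiSystem_isBounded_measurableSet isPiSystem_boundedVoidEvents balls whole ?_).symm
  rintro A ⟨hA, hAb⟩ _ ⟨U, ⟨hU, hUb⟩, rfl⟩
  rw [he.reducedCampbellMeasure_prod_voidEvent hA hU hUb,
    h.lintegral_encard_inter_setOf_disjoint_sdiff hA hAb hU,
    Measure.map_apply hΦ (measurableSet_voidEvent hU hUb)]
  rfl

theorem IsPoissonProcess.reduced_mecke_formula (h : IsPoissonProcess P (enumeratedSet num pt) lam)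
    (he : IsEnumeration P num pt) {F : Plane × Config Plane → ℝ≥0∞} (hF : Measurable F) :
    ∑' i : ℕ, ∫⁻ ω in {ω | (i : ℕ∞) < num ω}, F (pt i ω, otherPoints num pt i ω) ∂P =
      lam * ∫⁻ x, ∫⁻ ω, F (x, ⟨enumeratedSet num pt ω⟩) ∂P := by
  rw [← he.lintegral_reducedCampbellMeasure hF, h.reducedCampbellMeasure_eq he,
    lintegral_prod _ hF.aemeasurable, lintegral_smul_measure, ENNReal.smul_def, smul_eq_mul]
  congr 1
  exact lintegral_congr fun x => lintegral_map (hF.comp measurable_prodMk_left) h.measurable_config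

end MeckeFormula

section RadialIntegrals

theorem setIntegral_ball_fun_norm {E F : Type*} [NormedAddCommGroup E] [NormedSpace ℝ E]
    [FiniteDimensional ℝ E] [Nontrivial E] [MeasurableSpace E] [BorelSpace E]
    [NormedAddCommGroup F] [NormedSpace ℝ F] (μ : Measure E) [μ.IsAddHaarMeasure] (f : ℝ → F)
    (r : ℝ) :
    ∫ x in ball 0 r, f ‖x‖ ∂μ = Module.finrank ℝ E • μ.real (ball 0 1) •
      ∫ y in Set.Ioo 0 r, y ^ (Module.finrank ℝ E - 1) • f y := by
  have ball_indicator : (ball (0 : E) r).indicator (fun x => f ‖x‖) =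
      fun x => (Set.Iio r).indicator f ‖x‖ :=
    funext fun x => by simp [Set.indicator]
  rw [← integral_indicator measurableSet_ball, ball_indicator, integral_fun_norm_addHaar,
    ← Set.Ioi_inter_Iio, ← setIntegral_indicator measurableSet_Iio]
  simp only [Set.indicator_smul_apply]

theorem integral_mul_exp_neg_mul_sq {a : ℝ} (ha : a ≠ 0) (r : ℝ) :
    ∫ y in (0 : ℝ)..r, y * Real.exp (-(a * y ^ 2)) = (1 - Real.exp (-(a * r ^ 2))) / (2 * a) := by
  have hderiv : ∀ y ∈ Set.uIcc 0 r, HasDerivAt (fun y => -(Real.exp (-(a * y ^ 2)) / (2 * a)))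
      (y * Real.exp (-(a * y ^ 2))) y := fun y _ => by
    refine ((((hasDerivAt_pow 2 y).const_mul a).neg.exp).div_const (2 * a)).neg.congr_deriv ?_
    field_simp
    simp only [Pi.neg_apply, Nat.cast_ofNat, Nat.add_one_sub_one, pow_one]
    ring
  have hcont : Continuous fun y : ℝ => y * Real.exp (-(a * y ^ 2)) := by fun_prop
  rw [intervalIntegral.integral_eq_sub_of_hasDerivAt hderiv (hcont.intervalIntegrable _ _)]
  simp only [ne_eq, OfNat.ofNat_ne_zero, not_false_eq_true, zero_pow, mul_zero, neg_zero,
    Real.exp_zero]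
  ring

theorem volume_real_ball (x : Plane) (r : ℝ) :
    volume.real (ball x r) = max r 0 ^ 2 * Real.pi := by
  rw [measureReal_def, EuclideanSpace.volume_ball_fin_two, ENNReal.toReal_mul, ENNReal.toReal_pow,
    ENNReal.toReal_ofReal', ENNReal.toReal_ofReal Real.pi_pos.le]

theorem lintegral_ball_exp_neg_mul_sq {A r : ℝ} (hA : A ≠ 0) (hr : 0 ≤ r) :
    ∫⁻ x in ball (0 : Plane) r, ENNReal.ofReal (Real.exp (-(A * Real.pi * ‖x‖ ^ 2))) =
      ENNReal.ofReal ((1 - Real.exp (-(A * Real.pi * r ^ 2))) / A) := by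
  have hcont : Continuous fun x : Plane => Real.exp (-(A * Real.pi * ‖x‖ ^ 2)) := by fun_prop
  have hint : IntegrableOn (fun x : Plane => Real.exp (-(A * Real.pi * ‖x‖ ^ 2))) (ball 0 r) :=
    (hcont.continuousOn.integrableOn_compact (isCompact_closedBall 0 r)).mono_set
      ball_subset_closedBall
  rw [← ofReal_integral_eq_lintegral_ofReal hint (ae_of_all _ fun x => (Real.exp_nonneg _)),
    setIntegral_ball_fun_norm volume fun y => Real.exp (-(A * Real.pi * y ^ 2)), volume_real_ball,
    ← integral_Ioc_eq_integral_Ioo, ← intervalIntegral.integral_of_le hr]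
  have hpi := Real.pi_pos.ne'
  simp only [finrank_euclideanSpace_fin, Nat.add_one_sub_one, pow_one, smul_eq_mul,
    integral_mul_exp_neg_mul_sq (mul_ne_zero hA hpi)]
  congr 1
  simp only [zero_le_one, sup_of_le_left, one_pow, one_mul, nsmul_eq_mul, Nat.cast_ofNat]
  field_simp

theorem ofReal_mul_lintegral_ball_exp_neg_mul_sq {a A r : ℝ} (ha : 0 ≤ a) (haA : A = 0 → a = 0)
    (hr : 0 ≤ r) :
    ENNReal.ofReal a *
        ∫⁻ x in ball (0 : Plane) r, ENNReal.ofReal (Real.exp (-(A * Real.pi * ‖x‖ ^ 2))) =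
      ENNReal.ofReal (a * (1 - Real.exp (-A * Real.pi * r ^ 2)) / A) := by
  rcases eq_or_ne A 0 with hA | hA
  · simp [haA hA]
  · rw [lintegral_ball_exp_neg_mul_sq hA hr, ← ENNReal.ofReal_mul ha, neg_mul, neg_mul,
      mul_div_assoc]

end RadialIntegrals

theorem setLIntegral_prodMk_mem_of_indepFun {Ω α β : Type*} [MeasurableSpace Ω] [MeasurableSpace α]
    [MeasurableSpace β] {P : Measure Ω} [IsProbabilityMeasure P] {X : Ω → α} {Y : Ω → β}
    (hX : Measurable X) (hY : Measurable Y) (h : IndepFun X Y P) {S : Set (α × β)}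
    (hS : MeasurableSet S) {g : α → ℝ≥0∞} (hg : Measurable g) :
    ∫⁻ ω in {ω | (X ω, Y ω) ∈ S}, g (X ω) ∂P =
      ∫⁻ ω, P {ω' | (X ω, Y ω') ∈ S} * g (X ω) ∂P := by
  have hXY := hX.prodMk hY
  have hXYS : MeasurableSet {ω | (X ω, Y ω) ∈ S} := hXY hS
  have hF : Measurable fun v : α × β => S.indicator 1 v * g v.1 :=
    (measurable_one.indicator hS).mul (hg.comp measurable_fst)
  calc ∫⁻ ω in {ω | (X ω, Y ω) ∈ S}, g (X ω) ∂P
      = ∫⁻ ω, S.indicator 1 (X ω, Y ω) * g (X ω) ∂P := by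
        rw [← lintegral_indicator hXYS]
        exact lintegral_congr fun ω => by classical simp [Set.indicator_apply]
    _ = ∫⁻ v, S.indicator 1 v * g v.1 ∂(P.map X).prod (P.map Y) := by
        rw [← h.map_prod_eq_prod_map_map hX.aemeasurable hY.aemeasurable, lintegral_map hF hXY]
    _ = ∫⁻ ω, ∫⁻ ω', S.indicator 1 (X ω, Y ω') * g (X ω) ∂P ∂P := by
        rw [lintegral_prod _ hF.aemeasurable, lintegral_map hF.lintegral_prod_right' hX]
        exact lintegral_congr fun ω => lintegral_map (hF.comp measurable_prodMk_left) hY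
    _ = ∫⁻ ω, P {ω' | (X ω, Y ω') ∈ S} * g (X ω) ∂P := by
        refine lintegral_congr fun ω => ?_
        have hSω : MeasurableSet {ω' | (X ω, Y ω') ∈ S} := (measurable_prodMk_left.comp hY) hS
        rw [← lintegral_indicator_one hSω, ← lintegral_mul_const _ (measurable_one.indicator hSω)]
        rfl

/-- The probability that a Poisson process of density `lam` has no point in the disk `B`, which is
encoded as the pair of its centre and its radius. -/
noncomputable def voidProb (lam : ℝ) (B : Plane × ℝ) : ℝ≥0∞ :=
  ENNReal.ofReal (Real.exp (-(lam * volume.real (ball B.1 B.2))))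

theorem voidProb_ne_top (lam : ℝ) (B : Plane × ℝ) : voidProb lam B ≠ ∞ := ENNReal.ofReal_ne_top

theorem measurable_voidProb (lam : ℝ) : Measurable (voidProb lam) := by
  unfold voidProb
  simp only [volume_real_ball]
  fun_prop

/-- The probability that a node that transmits with probability `p` is in the mode `b`, where `true`
stands for transmitting and `false` for receiving. -/
noncomputable def modeProb (p : ℝ) (b : Bool) : ℝ≥0∞ :=
  ENNReal.ofReal (if b then p else 1 - p)

theorem modeProb_ne_top (p : ℝ) (b : Bool) : modeProb p b ≠ ∞ := ENNReal.ofReal_ne_top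

namespace Network

/-- The number and the positions of the nodes, together with their modes. -/
abbrev NodeData : Type := (ℕ∞ × (ℕ → Plane)) × (ℕ → Bool)

/-- The number and the positions of the nodes of a network. -/
def positions {Ω : Type*} (N : Network Ω) (ω : Ω) : ℕ∞ × (ℕ → Plane) :=
  (N.num ω, fun i => N.node i ω)

/-- The modes of the nodes of a network. -/
def modes {Ω : Type*} (N : Network Ω) (ω : Ω) (i : ℕ) : Bool := N.tx i ω

/-- The nodes, other than the node `i`, in the guard disk `dL x` of the position `x` of the
node `i`. -/
def guardNodes (dL : Plane → Plane × ℝ) (i : ℕ) (ξ : ℕ∞ × (ℕ → Plane)) : Set ℕ :=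
  {j | j ≠ i ∧ (j : ℕ∞) < ξ.1 ∧ ξ.2 j ∈ ball (dL (ξ.2 i)).1 (dL (ξ.2 i)).2}

/-- The event that the node `i` lies in `W` and is in mode `b`, while no other node in its guard
disk transmits. -/
def clearEvent (W : Set Plane) (dL : Plane → Plane × ℝ) (b : Bool) (i : ℕ) : Set NodeData :=
  {ξ | ((i : ℕ∞) < ξ.1.1 ∧ ξ.1.2 i ∈ W) ∧ ξ.2 i = b ∧ ∀ j ∈ guardNodes dL i ξ.1, ξ.2 j = false}

/-- The nodes `x` of mode `b` in `W` for which the disk `dL x` contains no other transmitter and the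
disk `dE x` contains no eavesdropper. Links from or to the origin are of this form. -/
def secureNodes {Ω : Type*} (N : Network Ω) (W : Set Plane) (dL dE : Plane → Plane × ℝ) (b : Bool)
    (ω : Ω) : Set ℕ :=
  {i | (N.positions ω, N.modes ω) ∈ clearEvent W dL b i ∧
    Config.mk (N.eves ω) ∈ voidEvent (ball (dE (N.node i ω)).1 (dE (N.node i ω)).2)}

theorem measurableSet_clearEvent {W : Set Plane} (hW : MeasurableSet W) {dL : Plane → Plane × ℝ}
    (hdL : Measurable dL) (b : Bool) (i : ℕ) : MeasurableSet (clearEvent W dL b i) := by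
  have present : ∀ j : ℕ, Measurable fun ξ : NodeData => (j : ℕ∞) < ξ.1.1 := fun j =>
    (Measurable.of_discrete (f := fun n : ℕ∞ => (j : ℕ∞) < n)).comp
      (measurable_fst.comp measurable_fst)
  have position : ∀ j : ℕ, Measurable fun ξ : NodeData => ξ.1.2 j := fun j => by fun_prop
  have mode : ∀ (j : ℕ) (c : Bool), Measurable fun ξ : NodeData => ξ.2 j = c := fun j c =>
    (Measurable.of_discrete (f := fun t : Bool => t = c)).comp
      ((measurable_pi_apply j).comp measurable_snd)
  have guard : Measurable fun ξ : NodeData => dL (ξ.1.2 i) := hdL.comp (position i)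
  refine measurableSet_setOfPred.2 (.and (.and (present i) ?_) (.and (mode i b)
    (Measurable.forall fun j => .imp (measurable_const.and (.and (present j) ?_)) (mode j _))))
  · exact measurableSet_setOfPred.1 (position i hW)
  · exact measurableSet_setOfPred.1 (measurableSet_lt ((position j).dist guard.fst) guard.snd)

/-- The conditional probability that a node at `v.1` lies in `W` and is in mode `b` while no other
node in its guard disk transmits, given that the other nodes form the configuration `v.2`. -/
noncomputable def clearProb (W : Set Plane) (dL : Plane → Plane × ℝ) (p : ℝ) (b : Bool)
    (v : Plane × Config Plane) : ℝ≥0∞ :=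
  W.indicator (fun x => modeProb p b *
    modeProb p false ^ (v.2.numPoints (ball (dL x).1 (dL x).2)).toNat) v.1

theorem measurable_clearProb {W : Set Plane} (hW : MeasurableSet W) {dL : Plane → Plane × ℝ}
    (hdL : Measurable dL) (p : ℝ) (b : Bool) : Measurable (clearProb W dL p b) := by
  have guardCount : Measurable fun v : Plane × Config Plane =>
      v.2.numPoints (ball (dL v.1).1 (dL v.1).2) :=
    measurable_numPoints_ball.comp ((hdL.comp measurable_fst).prodMk measurable_snd)
  have power : Measurable fun n : ℕ∞ => modeProb p b * modeProb p false ^ n.toNat := .of_discrete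
  exact (power.comp guardCount).indicator (measurable_fst hW)

theorem image_guardNodes {Ω : Type*} {N : Network Ω} {ω : Ω}
    (hinj : Set.InjOn (fun i => N.node i ω) {i : ℕ | (i : ℕ∞) < N.num ω}) {i : ℕ}
    (hi : (i : ℕ∞) < N.num ω) (dL : Plane → Plane × ℝ) :
    (fun j => N.node j ω) '' guardNodes dL i (N.positions ω) =
      (otherPoints N.num N.node i ω).points ∩
        ball (dL (N.node i ω)).1 (dL (N.node i ω)).2 := by
  ext x
  constructor
  · rintro ⟨j, ⟨hji, hj, hjb⟩, rfl⟩
    exact ⟨⟨⟨j, hj, rfl⟩, fun h => hji (hinj hj hi h)⟩, hjb⟩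
  · rintro ⟨⟨⟨j, hj, rfl⟩, hne⟩, hjb⟩
    exact ⟨j, ⟨fun h => hne (h ▸ rfl), hj, hjb⟩, rfl⟩

namespace IsAlohaModel

variable {Ω : Type*} [MeasurableSpace Ω] {N : Network Ω} {P : Measure Ω} {lamL lamE : ℝ≥0} {p : ℝ}
  {W : Set Plane} {dL dE : Plane → Plane × ℝ}

theorem isEnumeration (hN : N.IsAlohaModel P lamL lamE p) : IsEnumeration P N.num N.node :=
  ⟨hN.measurable_num, hN.measurable_node, hN.node_injOn⟩

theorem measurable_positions (hN : N.IsAlohaModel P lamL lamE p) : Measurable N.positions :=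
  hN.measurable_num.prodMk (measurable_pi_iff.2 hN.measurable_node)

theorem measurable_modes (hN : N.IsAlohaModel P lamL lamE p) : Measurable N.modes :=
  measurable_pi_iff.2 hN.measurable_tx

theorem measurable_nodeData (hN : N.IsAlohaModel P lamL lamE p) :
    Measurable fun ω => (N.positions ω, N.modes ω) :=
  hN.measurable_positions.prodMk hN.measurable_modes

theorem indepFun_nodeData_eves (hN : N.IsAlohaModel P lamL lamE p) :
    IndepFun (fun ω => (N.positions ω, N.modes ω)) (fun ω => Config.mk (N.eves ω)) P :=
  (IndepFun_iff_Indep _ _ _).2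
    (indep_of_indep_of_le_right hN.indep_eves (measurable_config_sigmaOf N.eves).comap_le)

theorem measurableSet_mem_secureNodes (hN : N.IsAlohaModel P lamL lamE p) (hW : MeasurableSet W)
    (hdL : Measurable dL) (hdE : Measurable dE) (b : Bool) (i : ℕ) :
    MeasurableSet {ω | i ∈ N.secureNodes W dL dE b ω} :=
  (hN.measurable_nodeData (measurableSet_clearEvent hW hdL b i)).inter
    (((hdE.comp (hN.measurable_node i)).prodMk hN.poisson_eves.measurable_config)
      measurableSet_mem_voidEvent_ball)

theorem lintegral_clearProb (hN : N.IsAlohaModel P lamL lamE p) (hp1 : p ≤ 1) (W : Set Plane)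
    (dL : Plane → Plane × ℝ) (b : Bool) (x : Plane) :
    ∫⁻ ω, clearProb W dL p b (x, ⟨N.legit ω⟩) ∂P =
      W.indicator (fun x => modeProb p b * voidProb (lamL * p) (dL x)) x := by
  by_cases hx : x ∈ W
  · simp only [clearProb, Set.indicator_of_mem hx]
    rw [lintegral_const_mul' _ _ (modeProb_ne_top p b)]
    congr 1
    refine (hN.poisson_legit.lintegral_pow_toNat_count measurableSet_ball isBounded_ball
      (1 - p).toNNReal).trans ?_
    rw [Real.coe_toNNReal _ (sub_nonneg.2 hp1), voidProb]
    congr 3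
    ring
  · simp only [clearProb, Set.indicator_of_notMem hx, lintegral_zero]

variable [IsProbabilityMeasure P]

theorem measure_mem_secureNodes (hN : N.IsAlohaModel P lamL lamE p) (hW : MeasurableSet W)
    (hdL : Measurable dL) (hdE : Measurable dE) (b : Bool) (i : ℕ) :
    P {ω | i ∈ N.secureNodes W dL dE b ω} =
      ∫⁻ ω in {ω | (N.positions ω, N.modes ω) ∈ clearEvent W dL b i},
        voidProb lamE (dE (N.node i ω)) ∂P := by
  have hC := measurableSet_clearEvent hW hdL b i
  have hdata : MeasurableSet {ω | (N.positions ω, N.modes ω) ∈ clearEvent W dL b i} :=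
    hN.measurable_nodeData hC
  let S : Set (NodeData × Config Plane) := {v | v.1 ∈ clearEvent W dL b i ∧
    v.2 ∈ voidEvent (ball (dE (v.1.1.2 i)).1 (dE (v.1.1.2 i)).2)}
  have hS : MeasurableSet S := (measurable_fst hC).inter
    (((hdE.comp (by fun_prop : Measurable fun v : NodeData × Config Plane => v.1.1.2 i)).prodMk
      measurable_snd) measurableSet_mem_voidEvent_ball)
  have average := setLIntegral_prodMk_mem_of_indepFun hN.measurable_nodeData
    hN.poisson_eves.measurable_config hN.indepFun_nodeData_eves hS measurable_one
  simp only [Pi.one_apply, setLIntegral_one, mul_one] at average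
  refine average.trans ?_
  rw [← lintegral_indicator hdata]
  refine lintegral_congr fun ω => ?_
  by_cases hω : (N.positions ω, N.modes ω) ∈ clearEvent W dL b i
  · simp only [S, Set.indicator, Set.mem_ofPred_eq, hω, true_and, if_true]
    exact hN.poisson_eves.measure_disjoint measurableSet_ball isBounded_ball
  · simp [S, hω]

theorem measure_tx_eq (hN : N.IsAlohaModel P lamL lamE p) (hp0 : 0 ≤ p) (i : ℕ) (b : Bool) :
    P {ω | N.tx i ω = b} = modeProb p b := by
  cases b
  · have silent : {ω | N.tx i ω = false} = {ω | N.tx i ω = true}ᶜ := by ext; simp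
    have measurableSet_tx : MeasurableSet {ω | N.tx i ω = true} :=
      hN.measurable_tx i (measurableSet_singleton true)
    rw [silent, prob_compl_eq_one_sub measurableSet_tx, hN.prob_tx, ← ENNReal.ofReal_one,
      ← ENNReal.ofReal_sub _ hp0]
    rfl
  · exact hN.prob_tx i

theorem measure_tx_eq_and_forall_tx_eq (hN : N.IsAlohaModel P lamL lamE p) (hp0 : 0 ≤ p) {i : ℕ}
    {J : Set ℕ} (hJ : J.Finite) (hi : i ∉ J) (b c : Bool) :
    P {ω | N.tx i ω = b ∧ ∀ j ∈ J, N.tx j ω = c} = modeProb p b * modeProb p c ^ J.ncard := by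
  classical
  lift J to Finset ℕ using hJ
  let mode : ℕ → Bool := fun j => if j = i then b else c
  have mode_of_mem : ∀ j ∈ J, mode j = c := fun j hj => if_neg (ne_of_mem_of_not_mem hj hi)
  have event_eq : {ω | N.tx i ω = b ∧ ∀ j ∈ (J : Set ℕ), N.tx j ω = c} =
      ⋂ j ∈ insert i J, N.tx j ⁻¹' {mode j} := by
    ext ω
    simp +contextual [mode, mode_of_mem]
  rw [event_eq, hN.indep_tx.measure_inter_preimage_eq_mul _ fun _ _ => .of_discrete]
  simp only [Set.preimage, Set.mem_singleton_iff, hN.measure_tx_eq hp0]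
  rw [Finset.prod_insert hi, Finset.prod_congr rfl fun j hj => by rw [mode_of_mem j hj],
    Finset.prod_const, Set.ncard_coe_finset]
  simp only [mode, if_true]

theorem measure_modes_mem_clearEvent (hN : N.IsAlohaModel P lamL lamE p) (hp0 : 0 ≤ p) {ω : Ω}
    (hinj : Set.InjOn (fun i => N.node i ω) {i : ℕ | (i : ℕ∞) < N.num ω})
    (hfin : ∀ B, Bornology.IsBounded B → (N.legit ω ∩ B).Finite)
    (W : Set Plane) (dL : Plane → Plane × ℝ) (b : Bool) (i : ℕ) :
    P {ω' | (N.positions ω, N.modes ω') ∈ clearEvent W dL b i} =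
      {ω | (i : ℕ∞) < N.num ω}.indicator
        (fun ω => clearProb W dL p b (N.node i ω, otherPoints N.num N.node i ω)) ω := by
  by_cases hi : (i : ℕ∞) < N.num ω ∧ N.node i ω ∈ W
  · let J : Set ℕ := guardNodes dL i (N.positions ω)
    have node_injOn : Set.InjOn (fun j => N.node j ω) J := hinj.mono fun j hj => hj.2.1
    have image_J := image_guardNodes hinj hi.1 dL
    have finite_J : J.Finite := .of_finite_image (image_J ▸ (hfin _ isBounded_ball).subset
      (Set.inter_subset_inter_left _ Set.sdiff_subset)) node_injOn
    have event_eq : {ω' | (N.positions ω, N.modes ω') ∈ clearEvent W dL b i} =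
        {ω' | N.tx i ω' = b ∧ ∀ j ∈ J, N.tx j ω' = false} :=
      Set.ext fun _ => and_iff_right hi
    rw [event_eq, hN.measure_tx_eq_and_forall_tx_eq hp0 finite_J (fun h => h.1 rfl),
      Set.indicator_of_mem (show ω ∈ {ω | (i : ℕ∞) < N.num ω} from hi.1), clearProb,
      Set.indicator_of_mem hi.2, Config.numPoints, ← image_J, ← Set.ncard_def,
      node_injOn.ncard_image]
  · have event_eq : {ω' | (N.positions ω, N.modes ω') ∈ clearEvent W dL b i} = ∅ :=
      Set.eq_empty_of_forall_notMem fun _ h => hi h.1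
    rw [event_eq, measure_empty, eq_comm, Set.indicator_apply_eq_zero]
    exact fun hi_lt => Set.indicator_of_notMem (fun hW => hi ⟨hi_lt, hW⟩) _

theorem measure_mem_secureNodes_eq_lintegral (hN : N.IsAlohaModel P lamL lamE p) (hp0 : 0 ≤ p)
    (hW : MeasurableSet W) (hdL : Measurable dL) (hdE : Measurable dE) (b : Bool) (i : ℕ) :
    P {ω | i ∈ N.secureNodes W dL dE b ω} =
      ∫⁻ ω in {ω | (i : ℕ∞) < N.num ω},
        clearProb W dL p b (N.node i ω, otherPoints N.num N.node i ω) *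
          voidProb lamE (dE (N.node i ω)) ∂P := by
  have measurable_eveProb : Measurable fun ξ : ℕ∞ × (ℕ → Plane) => voidProb lamE (dE (ξ.2 i)) :=
    (measurable_voidProb lamE).comp (hdE.comp (by fun_prop))
  have average := setLIntegral_prodMk_mem_of_indepFun hN.measurable_positions hN.measurable_modes
    hN.indep_node_tx (measurableSet_clearEvent hW hdL b i) measurable_eveProb
  rw [hN.measure_mem_secureNodes hW hdL hdE,
    ← lintegral_indicator (hN.isEnumeration.measurableSet_lt_num i)]
  refine average.trans (lintegral_congr_ae ?_)
  filter_upwards [hN.node_injOn, hN.poisson_legit.locallyFinite] with ω hinj hfin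
  rw [hN.measure_modes_mem_clearEvent hp0 hinj hfin, Set.indicator_mul_left]
  rfl

theorem lintegral_encard_secureNodes (hN : N.IsAlohaModel P lamL lamE p) (hp0 : 0 ≤ p)
    (hp1 : p ≤ 1) (hW : MeasurableSet W) (hdL : Measurable dL) (hdE : Measurable dE) (b : Bool) :
    ∫⁻ ω, (N.secureNodes W dL dE b ω).encard ∂P =
      modeProb p b * (lamL * ∫⁻ x in W, voidProb (lamL * p) (dL x) * voidProb lamE (dE x)) := by
  have hF : Measurable fun v : Plane × Config Plane =>
      clearProb W dL p b v * voidProb lamE (dE v.1) :=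
    (measurable_clearProb hW hdL p b).mul
      ((measurable_voidProb lamE).comp (hdE.comp measurable_fst))
  calc ∫⁻ ω, (N.secureNodes W dL dE b ω).encard ∂P
      = ∑' i : ℕ, ∫⁻ ω in {ω | (i : ℕ∞) < N.num ω},
          clearProb W dL p b (N.node i ω, otherPoints N.num N.node i ω) *
            voidProb lamE (dE (N.node i ω)) ∂P := by
        rw [lintegral_coe_encard (hN.measurableSet_mem_secureNodes hW hdL hdE b)]
        exact tsum_congr fun i => hN.measure_mem_secureNodes_eq_lintegral hp0 hW hdL hdE b i
    _ = lamL * ∫⁻ x, ∫⁻ ω, clearProb W dL p b (x, ⟨N.legit ω⟩) * voidProb lamE (dE x) ∂P :=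
        hN.poisson_legit.reduced_mecke_formula hN.isEnumeration hF
    _ = lamL * ∫⁻ x in W, modeProb p b * (voidProb (lamL * p) (dL x) * voidProb lamE (dE x)) := by
        rw [← lintegral_indicator hW]
        congr 1
        refine lintegral_congr fun x => ?_
        rw [lintegral_mul_const' _ _ (voidProb_ne_top _ _), hN.lintegral_clearProb hp1]
        simp only [← mul_assoc]
        exact (Set.indicator_mul_left W (fun x => modeProb p b * voidProb (lamL * p) (dL x))
          fun x => voidProb lamE (dE x)).symm
    _ = _ := by
        rw [lintegral_const_mul' _ _ (modeProb_ne_top p b)]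
        exact mul_left_comm _ _ _

theorem lintegral_encard_secureNodes_ball (hN : N.IsAlohaModel P lamL lamE p) (hp0 : 0 ≤ p)
    (hp1 : p ≤ 1) {cL cE : Plane → Plane} (hcL : Measurable cL) (hcE : Measurable cE) (η : ℝ)
    {βl βe : ℝ} (hβl : 0 ≤ βl) (hβe : 0 ≤ βe) (b : Bool) :
    ∫⁻ ω, (N.secureNodes (ball 0 η) (fun x => (cL x, βl * ‖x‖)) (fun x => (cE x, βe * ‖x‖)) b
        ω).encard ∂P =
      modeProb p b * (lamL * ∫⁻ x in ball (0 : Plane) η, ENNReal.ofReal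
        (Real.exp (-((lamL * p * βl ^ 2 + lamE * βe ^ 2) * Real.pi * ‖x‖ ^ 2)))) := by
  rw [hN.lintegral_encard_secureNodes hp0 hp1 measurableSet_ball (by fun_prop) (by fun_prop)]
  congr 2
  refine lintegral_congr fun x => ?_
  rw [voidProb, voidProb, ← ENNReal.ofReal_mul (Real.exp_nonneg _), ← Real.exp_add,
    volume_real_ball, volume_real_ball, max_eq_left (by positivity), max_eq_left (by positivity)]
  congr 2
  ring

end IsAlohaModel

variable {Ω : Type*} {N : Network Ω} {W : Set Plane} {dL dE : Plane → Plane × ℝ} {ω : Ω}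

theorem node_mem_transmitters_iff
    (hinj : Set.InjOn (fun i => N.node i ω) {i : ℕ | (i : ℕ∞) < N.num ω}) {i : ℕ}
    (hi : (i : ℕ∞) < N.num ω) : N.node i ω ∈ N.transmitters ω ↔ N.tx i ω = true := by
  refine ⟨?_, fun hti => ⟨i, hi, hti, rfl⟩⟩
  rintro ⟨j, hj, htj, hji⟩
  rwa [← hinj hj hi hji]

theorem forall_guardNodes_silent_iff
    (hinj : Set.InjOn (fun i => N.node i ω) {i : ℕ | (i : ℕ∞) < N.num ω}) {i : ℕ}
    (hi : (i : ℕ∞) < N.num ω) (dL : Plane → Plane × ℝ) :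
    (∀ j ∈ guardNodes dL i (N.positions ω), N.modes ω j = false) ↔
      ∀ z ∈ N.transmitters ω, z ≠ N.node i ω →
        z ∉ ball (dL (N.node i ω)).1 (dL (N.node i ω)).2 := by
  constructor
  · rintro h _ ⟨j, hj, htj, rfl⟩ hne hjb
    have silent : N.tx j ω = false := h j ⟨fun hji => hne (hji ▸ rfl), hj, hjb⟩
    exact Bool.false_ne_true (silent.symm.trans htj)
  · rintro h j ⟨hji, hj, hjb⟩
    exact Bool.eq_false_iff.2 fun htj =>
      h _ ⟨j, hj, htj, rfl⟩ (fun hij => hji (hinj hj hi hij)) hjb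

theorem mem_secureNodes_iff
    (hinj : Set.InjOn (fun i => N.node i ω) {i : ℕ | (i : ℕ∞) < N.num ω}) {b : Bool} {i : ℕ} :
    i ∈ N.secureNodes W dL dE b ω ↔ (i : ℕ∞) < N.num ω ∧ N.tx i ω = b ∧ N.node i ω ∈ W ∧
      (∀ z ∈ N.transmitters ω, z ≠ N.node i ω →
        z ∉ ball (dL (N.node i ω)).1 (dL (N.node i ω)).2) ∧
      ∀ z ∈ N.eves ω, z ∉ ball (dE (N.node i ω)).1 (dE (N.node i ω)).2 := by
  constructor
  · rintro ⟨⟨⟨hi, hiW⟩, hti, silent⟩, noEve⟩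
    exact ⟨hi, hti, hiW, (forall_guardNodes_silent_iff hinj hi dL).1 silent,
      fun _ hz => Set.disjoint_left.1 noEve hz⟩
  · rintro ⟨hi, hti, hiW, noInterferer, noEve⟩
    exact ⟨⟨⟨hi, hiW⟩, hti, (forall_guardNodes_silent_iff hinj hi dL).2 noInterferer⟩,
      Set.disjoint_left.2 noEve⟩

theorem encard_image_secureNodes
    (hinj : Set.InjOn (fun i => N.node i ω) {i : ℕ | (i : ℕ∞) < N.num ω}) (b : Bool) :
    ((fun i => N.node i ω) '' N.secureNodes W dL dE b ω).encard =
      (N.secureNodes W dL dE b ω).encard :=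
  (hinj.mono fun _ hi => hi.1.1.1).encard_image

theorem inDegree_eq_encard_secureNodes
    (hinj : Set.InjOn (fun i => N.node i ω) {i : ℕ | (i : ℕ∞) < N.num ω}) (η βl βe : ℝ) :
    N.inDegree η βl βe ω = (N.secureNodes (ball 0 η) (fun x => (0, βl * ‖x‖))
      (fun x => (x, βe * ‖x‖)) true ω).encard := by
  rw [← encard_image_secureNodes hinj, inDegree]
  congr 1
  ext x
  constructor
  · rintro ⟨⟨i, hi, hti, rfl⟩, -, hclose, noInterferer, noEve⟩
    rw [sub_zero] at hclose noInterferer noEve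
    exact ⟨i, (mem_secureNodes_iff hinj).2
      ⟨hi, hti, mem_ball_zero_iff.2 hclose, noInterferer, noEve⟩, rfl⟩
  · rintro ⟨i, hsecure, rfl⟩
    obtain ⟨hi, hti, hclose, noInterferer, noEve⟩ := (mem_secureNodes_iff hinj).1 hsecure
    refine ⟨⟨i, hi, hti, rfl⟩, Set.mem_insert _ _, ?_, ?_, ?_⟩ <;> rw [sub_zero]
    exacts [mem_ball_zero_iff.1 hclose, noInterferer, noEve]

theorem outDegree_eq_encard_secureNodes
    (hinj : Set.InjOn (fun i => N.node i ω) {i : ℕ | (i : ℕ∞) < N.num ω})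
    (h0 : (0 : Plane) ∉ N.legit ω) (η βl βe : ℝ) :
    N.outDegree η βl βe ω = (N.secureNodes (ball 0 η) (fun x => (x, βl * ‖x‖))
      (fun x => (0, βe * ‖x‖)) false ω).encard := by
  rw [← encard_image_secureNodes hinj, outDegree]
  congr 1
  ext y
  constructor
  · rintro ⟨-, ⟨⟨i, hi, rfl⟩, not_tx⟩, hclose, noInterferer, noEve⟩
    rw [zero_sub, norm_neg] at hclose noInterferer noEve
    rw [node_mem_transmitters_iff hinj hi, Bool.not_eq_true] at not_tx
    refine ⟨i, (mem_secureNodes_iff hinj).2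
      ⟨hi, not_tx, mem_ball_zero_iff.2 hclose, fun z hz _ => ?_, noEve⟩, rfl⟩
    refine noInterferer z (Set.mem_insert_of_mem _ hz) ?_
    rintro rfl
    obtain ⟨j, hj, -, hj0⟩ := hz
    exact h0 ⟨j, hj, hj0⟩
  · rintro ⟨i, hsecure, rfl⟩
    obtain ⟨hi, hti, hclose, noInterferer, noEve⟩ := (mem_secureNodes_iff hinj).1 hsecure
    have not_tx : N.node i ω ∉ N.transmitters ω := by
      rw [node_mem_transmitters_iff hinj hi, hti]
      exact Bool.false_ne_true
    refine ⟨Set.mem_insert _ _, ⟨⟨i, hi, rfl⟩, not_tx⟩, ?_, ?_, ?_⟩ <;> rw [zero_sub, norm_neg]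
    · exact mem_ball_zero_iff.1 hclose
    · rintro z hz hz0
      have hzT := Set.mem_of_mem_insert_of_ne hz hz0
      exact noInterferer z hzT (ne_of_mem_of_not_mem hzT not_tx)
    · exact noEve

namespace IsAlohaModel

variable [MeasurableSpace Ω] {P : Measure Ω} {lamL lamE : ℝ≥0} {p : ℝ}

theorem inDegree_ae_eq (hN : N.IsAlohaModel P lamL lamE p) (η βl βe : ℝ) :
    (fun ω => (N.inDegree η βl βe ω : ℝ≥0∞)) =ᵐ[P] fun ω => (N.secureNodes (ball 0 η)
      (fun x => (0, βl * ‖x‖)) (fun x => (x, βe * ‖x‖)) true ω).encard :=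
  hN.node_injOn.mono fun _ hinj =>
    congrArg ENat.toENNReal (inDegree_eq_encard_secureNodes hinj η βl βe)

theorem aemeasurable_inDegree (hN : N.IsAlohaModel P lamL lamE p) (η βl βe : ℝ) :
    AEMeasurable (fun ω => (N.inDegree η βl βe ω : ℝ≥0∞)) P :=
  ⟨_, measurable_coe_encard (hN.measurableSet_mem_secureNodes measurableSet_ball (by fun_prop)
    (by fun_prop) true), hN.inDegree_ae_eq η βl βe⟩

variable [IsProbabilityMeasure P]

theorem lintegral_inDegree (hN : N.IsAlohaModel P lamL lamE p) (hp0 : 0 ≤ p) (hp1 : p ≤ 1)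
    (η : ℝ) {βl βe : ℝ} (hβl : 0 ≤ βl) (hβe : 0 ≤ βe) :
    ∫⁻ ω, N.inDegree η βl βe ω ∂P =
      ENNReal.ofReal p * (lamL * ∫⁻ x in ball (0 : Plane) η, ENNReal.ofReal
        (Real.exp (-((lamL * p * βl ^ 2 + lamE * βe ^ 2) * Real.pi * ‖x‖ ^ 2)))) :=
  (lintegral_congr_ae (hN.inDegree_ae_eq η βl βe)).trans
    (hN.lintegral_encard_secureNodes_ball hp0 hp1 measurable_const measurable_id η hβl hβe true)

theorem outDegree_ae_eq (hN : N.IsAlohaModel P lamL lamE p) (η βl βe : ℝ) :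
    (fun ω => (N.outDegree η βl βe ω : ℝ≥0∞)) =ᵐ[P] fun ω => (N.secureNodes (ball 0 η)
      (fun x => (x, βl * ‖x‖)) (fun x => (0, βe * ‖x‖)) false ω).encard := by
  filter_upwards [hN.node_injOn, hN.poisson_legit.ae_notMem 0] with ω hinj h0
  rw [outDegree_eq_encard_secureNodes hinj h0]

theorem aemeasurable_outDegree (hN : N.IsAlohaModel P lamL lamE p) (η βl βe : ℝ) :
    AEMeasurable (fun ω => (N.outDegree η βl βe ω : ℝ≥0∞)) P :=
  ⟨_, measurable_coe_encard (hN.measurableSet_mem_secureNodes measurableSet_ball (by fun_prop)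
    (by fun_prop) false), hN.outDegree_ae_eq η βl βe⟩

theorem lintegral_outDegree (hN : N.IsAlohaModel P lamL lamE p) (hp0 : 0 ≤ p) (hp1 : p ≤ 1)
    (η : ℝ) {βl βe : ℝ} (hβl : 0 ≤ βl) (hβe : 0 ≤ βe) :
    ∫⁻ ω, N.outDegree η βl βe ω ∂P =
      ENNReal.ofReal (1 - p) * (lamL * ∫⁻ x in ball (0 : Plane) η, ENNReal.ofReal
        (Real.exp (-((lamL * p * βl ^ 2 + lamE * βe ^ 2) * Real.pi * ‖x‖ ^ 2)))) :=
  (lintegral_congr_ae (hN.outDegree_ae_eq η βl βe)).trans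
    (hN.lintegral_encard_secureNodes_ball hp0 hp1 measurable_id measurable_const η hβl hβe false)

theorem lintegral_inDegree_eq_mul_lintegral_outDegree (hN : N.IsAlohaModel P lamL lamE p)
    (hp0 : 0 ≤ p) (hp1 : p < 1) (η : ℝ) {βl βe : ℝ} (hβl : 0 ≤ βl) (hβe : 0 ≤ βe) :
    ∫⁻ ω, N.inDegree η βl βe ω ∂P =
      ENNReal.ofReal (p / (1 - p)) * ∫⁻ ω, N.outDegree η βl βe ω ∂P := by
  have hq : 0 < 1 - p := sub_pos.2 hp1
  rw [hN.lintegral_inDegree hp0 hp1.le η hβl hβe, hN.lintegral_outDegree hp0 hp1.le η hβl hβe,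
    ← mul_assoc (ENNReal.ofReal (p / (1 - p))), ← ENNReal.ofReal_mul (div_nonneg hp0 hq.le),
    div_mul_cancel₀ _ hq.ne']

end IsAlohaModel

end Network

theorem mainTheorem2 {Ω : Type*} [MeasurableSpace Ω] (P : Measure Ω) [IsProbabilityMeasure P]
    (lamL lamE : ℝ≥0) (p η βl βe : ℝ) (hp0 : 0 ≤ p) (hp1 : p ≤ 1)
    (hη : 0 < η) (hβl : 0 < βl) (hβe : 0 < βe)
    (N : Network Ω) (hN : N.IsAlohaModel P lamL lamE p) :
    AEMeasurable (fun ω => (N.inDegree η βl βe ω : ℝ≥0∞)) P ∧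
    ∫⁻ ω, (N.inDegree η βl βe ω : ℝ≥0∞) ∂P =
      ENNReal.ofReal
        (lamL * p * (1 - Real.exp (-(lamL * p * βl ^ 2 + lamE * βe ^ 2) * Real.pi * η ^ 2)) /
          (lamL * p * βl ^ 2 + lamE * βe ^ 2)) ∧
    (p < 1 →
      AEMeasurable (fun ω => (N.outDegree η βl βe ω : ℝ≥0∞)) P ∧
      ∫⁻ ω, (N.inDegree η βl βe ω : ℝ≥0∞) ∂P =
        ENNReal.ofReal (p / (1 - p)) * ∫⁻ ω, (N.outDegree η βl βe ω : ℝ≥0∞) ∂P) := by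
  refine ⟨hN.aemeasurable_inDegree η βl βe, ?_, fun hp => ⟨hN.aemeasurable_outDegree η βl βe,
    hN.lintegral_inDegree_eq_mul_lintegral_outDegree hp0 hp η hβl.le hβe.le⟩⟩
  have intensity_nonneg : 0 ≤ lamL * p := by positivity
  have intensity_eq_zero (h : lamL * p * βl ^ 2 + lamE * βe ^ 2 = 0) : lamL * p = 0 := by
    have hl : lamL * p * βl ^ 2 = 0 :=
      ((add_eq_zero_iff_of_nonneg (by positivity) (by positivity)).1 h).1
    exact (mul_eq_zero.1 hl).resolve_right (by positivity)
  rw [hN.lintegral_inDegree hp0 hp1 η hβl.le hβe.le, ← mul_assoc, ← ENNReal.ofReal_coe_nnreal,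
    ← ENNReal.ofReal_mul hp0, mul_comm p,
    ofReal_mul_lintegral_ball_exp_neg_mul_sq intensity_nonneg intensity_eq_zero hη.le]
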